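/- **The PDQP query model.** Let $N\in\mathbb N$ and let $x:\{0,\dots,N-1\}\to\{0,1\}$ be an input. A PDQP query algorithm for inputs of size $N$ consists of a circuit on $l=a+1+w$ qubits (an index register of $a$ qubits with $2^a\ge N$, one control qubit, and $w$ workspace qubits) and of a classical post-processing function. The circuit does not depend on $x$ except through its oracle gates, starts in $|0\rangle^{\otimes l}$, and is a finite sequence of steps. Step $t$ applies an arbitrary unitary $U_t$ on the $l$ qubits, then a collapsing measurement of a (possibly empty) subset of the qubits in the computational basis, and then does exactly one of the following: * a *query*: it applies the phase oracle $O_x:|i,b,z\rangle\mapsto(-1)^{x(i)\cdot b}|i,b,z\rangle$ (the identity on $|i,b,z\rangle$ if $i\ge N$); * a *non-collapsing measurement*: it outputs a sample $v_t\in\{0,1\}^l$ distributed as a measurement of all qubits of the current state in the computational basis, fresh randomness being used for every sample, while the state itself is left unchanged. At the end the post-processing function maps the list of all samples $v_t$ to one output bit. Let $Q$ be the number of query steps and $P$ the number of non-collapsing measurement steps. The algorithm *solves search* on $N$ items if, for every $x:\{0,\dots,N-1\}\to\{0,1\}$, it outputs with error probability at most $1/3$ whether there is an $i$ with $x(i)=1$.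 **Theorem.** (Lower bound) There is a constant $c>0$ such that for every $N$, every PDQP query algorithm that solves search on $N$ items, with $Q$ queries and $P$ non-collapsing measurements, satisfies $$Q+P\ \ge\ c\,N^{1/3}.$$ (Tightness) The bound is tight up to logarithmic factors: there are constants $C>0$ and $k\in\mathbb N$ such that for every $N\ge 2$ there is a PDQP query algorithm that solves search on $N$ items with $$Q+P\ \le\ C\,N^{1/3}(\log N)^k .$$ Hence the complexity $Q+P$ of search in the PDQP query model is $\tilde\Theta(N^{1/3})$. -/

import Mathlib

/-!
The quantum query model with non-collapsing measurements (PDQP).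

A circuit on `l` qubits is a list of steps. A step applies a unitary gate to the current state and
then a collapsing measurement, in the computational basis, of a (possibly empty) set of qubits.
After that the step either applies the query operator of the input, or yields a non-collapsing
measurement: a sample of the current state in the computational basis that leaves the state
unchanged. At the end, a classical post-processing turns the list of all samples into one bit.
-/

noncomputable section

namespace PDQP

/-- Computational basis states of `l` qubits. -/
abbrev Basis (l : ℕ) : Type := Fin l → Bool

/-- Vectors of amplitudes of `l` qubits. -/
abbrev State (l : ℕ) : Type := Basis l → ℂ

/-- The state `|0…0⟩`. -/
def zeroState (l : ℕ) : State l := Pi.single (fun _ => false) 1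

/-- Born rule: the probability that measuring the qubits in `S` of the (unit) state `ψ` gives the
outcome `m`. -/
def outcomeProb {l : ℕ} (S : Finset (Fin l)) (ψ : State l) (m : S → Bool) : ℝ :=
  ∑ b : Basis l with S.restrict b = m, ‖ψ b‖ ^ 2

/-- The normalized state to which `ψ` collapses when measuring the qubits in `S` gives `m`
(only relevant if this outcome has positive probability). -/
def collapse {l : ℕ} (S : Finset (Fin l)) (ψ : State l) (m : S → Bool) : State l :=
  fun b => if S.restrict b = m then ψ b / ((√(outcomeProb S ψ m) : ℝ) : ℂ) else 0

/-- One step of a circuit: a unitary gate, a collapsing measurement of the qubits in `measured`,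
and then either a query (`isQuery = true`) or a non-collapsing measurement (`isQuery = false`). -/
structure Step (l : ℕ) where
  gate : Matrix.unitaryGroup (Basis l) ℂ
  measured : Finset (Fin l)
  isQuery : Bool

/-- The probability that running the steps from the state `ψ`, with query operator `O`, produces
a chronological list `vs` of non-collapsing measurement results such that `post vs = y`. -/
def outputProb {l : ℕ} (O : State l → State l) (y : Bool) :
    List (Step l) → State l → (List (Basis l) → Bool) → ℝ
  | [], _, post => if post [] = y then 1 else 0
  | s :: steps, ψ, post =>
      let φ : State l := Matrix.mulVec s.gate.1 ψ
      ∑ m : s.measured → Bool,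
        outcomeProb s.measured φ m *
          (let χ : State l := collapse s.measured φ m
           if s.isQuery then outputProb O y steps (O χ) post
           else ∑ v : Basis l, ‖χ v‖ ^ 2 * outputProb O y steps χ (fun vs => post (v :: vs)))

/-- The index held by the index register, which consists of the first `a` qubits. -/
def queryIndex {a w : ℕ} (b : Basis (a + 1 + w)) : ℕ :=
  Nat.ofBits fun j : Fin a => b (Fin.castAdd w j.castSucc)

/-- The control bit of the query, which is the qubit right after the index register. -/
def queryBit {a w : ℕ} (b : Basis (a + 1 + w)) : Bool :=
  b (Fin.castAdd w (Fin.last a))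

/-- The phase oracle `|i, c, z⟩ ↦ (-1) ^ (x i * c) |i, c, z⟩` of the input `x`; basis states whose
index register holds some `i ≥ N` are left unchanged. -/
def phaseOracle {N : ℕ} (a w : ℕ) (x : Fin N → Bool) (ψ : State (a + 1 + w)) :
    State (a + 1 + w) :=
  fun b =>
    if ∃ i : Fin N, (i : ℕ) = queryIndex b ∧ x i = true ∧ queryBit b = true then -ψ b else ψ b

/-- A query algorithm with non-collapsing measurements for inputs `x : Fin N → Bool`. -/
structure Algorithm (N : ℕ) where
  /-- number of qubits of the index register -/
  indexQubits : ℕ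
  /-- every input position has an address -/
  le_two_pow : N ≤ 2 ^ indexQubits
  /-- number of workspace qubits -/
  workQubits : ℕ
  /-- the circuit -/
  steps : List (Step (indexQubits + 1 + workQubits))
  /-- classical post-processing of the non-collapsing measurement results -/
  post : List (Basis (indexQubits + 1 + workQubits)) → Bool

namespace Algorithm

variable {N : ℕ}

/-- `Q`: the number of steps that perform a query. -/
def queries (A : Algorithm N) : ℕ := A.steps.countP fun s => s.isQuery

/-- `P`: the number of steps that perform a non-collapsing measurement. -/
def samples (A : Algorithm N) : ℕ := A.steps.countP fun s => !s.isQuery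

/-- The probability that `A` outputs `y` on input `x`. -/
def prob (A : Algorithm N) (x : Fin N → Bool) (y : Bool) : ℝ :=
  outputProb (phaseOracle A.indexQubits A.workQubits x) y A.steps
    (zeroState (A.indexQubits + 1 + A.workQubits)) A.post

/-- `A` decides, with error probability at most `1/3` on every input, whether there is a marked
item. -/
def SolvesSearch (A : Algorithm N) : Prop :=
  ∀ x : Fin N → Bool, 2 / 3 ≤ A.prob x (decide (∃ i, x i = true))

end Algorithm

end PDQP

end

/-! Lower bound. Fix a position `i` and compare the run on the all-zero input with the run on the
input that marks only `i`. The output distributions are compared through their affinity `∑ y, √(p y)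
* √(q y)`: a sample taken from states `u`, `v` lowers it by at most `‖u - v‖² / 2`
(`affinity_sample_ge`). This loss is quadratic in the distance; a total variation estimate would
lose a linear term per sample and yield only `N^(1/4)`. A query multiplies the squared distance by
at most `1 + ε` and adds `4 (1 + 1/ε)` times the mass that the all-zero run has on `i`. With `ε =
1/(Q+1)` the total loss is `O((P+1)(Q+2) W_i)`, where `W_i` is the mass that the all-zero run
queries at `i` (`affinity_ge`). A correct algorithm needs a constant loss for every `i`, while `∑
W_i ≤ Q` (`sum_queryMass_le`); hence `N = O((P+1)(Q+2)Q)` (`search_lower_bound`). Collapsing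
measurements are harmless because branches are kept unnormalized: squared distances add up over
outcomes, and Cauchy–Schwarz merges the affinities of the branches.

Upper bound. Samples leave the state intact, so one Grover run can be sampled after every iteration.
If the marked fraction is `sin² θ`, then `K` samples all miss with probability `∏ cos²((2j+1)θ) ≤
exp(-∑ sin²((2j+1)θ))`. While the angles stay small the sum grows like `K³ θ²`, and `θ²` is at least
of order `1/N`, so `K = O(N^(1/3))` suffices (`prod_cos_sq_le`), without logarithmic factors. -/

noncomputable section

namespace PDQP

open scoped Matrix

/-! ### Norms, projections and phase flips -/

variable {l : ℕ}

/-- The squared Euclidean norm of a vector of amplitudes. -/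
def normSq (ψ : State l) : ℝ := ∑ b, ‖ψ b‖ ^ 2

/-- The unnormalized state after measuring the qubits in `S` with outcome `m`. -/
def proj (S : Finset (Fin l)) (m : S → Bool) (ψ : State l) : State l :=
  fun b => if S.restrict b = m then ψ b else 0

open Classical in
/-- The operator that negates the amplitudes of the basis states in `M`. -/
def phaseFlip (M : Set (Basis l)) (ψ : State l) : State l :=
  fun b => if b ∈ M then -ψ b else ψ b

theorem normSq_nonneg (ψ : State l) : 0 ≤ normSq ψ :=
  Finset.sum_nonneg fun _ _ => by positivity

theorem normSq_zero : normSq (0 : State l) = 0 := by simp [normSq]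

theorem normSq_eq_zero {ψ : State l} (h : normSq ψ = 0) : ψ = 0 := by
  funext b
  have := (Finset.sum_eq_zero_iff_of_nonneg (fun b _ => by positivity)).1 h b (Finset.mem_univ b)
  simpa using this

theorem normSq_smul (c : ℝ) (ψ : State l) : normSq ((c : ℂ) • ψ) = c ^ 2 * normSq ψ := by
  simp [normSq, mul_pow, Finset.mul_sum]

theorem normSq_zeroState : normSq (zeroState l) = 1 := by
  rw [normSq, Finset.sum_eq_single (fun _ => false)]
  · simp [zeroState]
  · intro b _ hb
    simp [zeroState, hb]
  · simp

theorem coe_normSq (ψ : State l) : ((normSq ψ : ℝ) : ℂ) = star ψ ⬝ᵥ ψ := by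
  simp [normSq, dotProduct, Complex.conj_mul']

theorem normSq_mulVec (U : Matrix.unitaryGroup (Basis l) ℂ) (ψ : State l) :
    normSq (U.1 *ᵥ ψ) = normSq ψ := by
  have h : (U.1)ᴴ * U.1 = 1 := Matrix.mem_unitaryGroup_iff'.1 U.2
  have : ((normSq (U.1 *ᵥ ψ) : ℝ) : ℂ) = ((normSq ψ : ℝ) : ℂ) := by
    rw [coe_normSq, coe_normSq, Matrix.star_mulVec, Matrix.dotProduct_mulVec,
      Matrix.vecMul_vecMul, h, Matrix.vecMul_one]
  exact_mod_cast this

theorem normSq_phaseFlip (M : Set (Basis l)) (ψ : State l) :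
    normSq (phaseFlip M ψ) = normSq ψ := by
  refine Finset.sum_congr rfl fun b _ => ?_
  unfold phaseFlip
  split_ifs <;> simp

theorem phaseFlip_smul (M : Set (Basis l)) (c : ℂ) (ψ : State l) :
    phaseFlip M (c • ψ) = c • phaseFlip M ψ := by
  funext b
  simp only [phaseFlip, Pi.smul_apply]
  split_ifs <;> simp

theorem phaseFlip_empty (ψ : State l) : phaseFlip ∅ ψ = ψ := by
  funext b
  simp [phaseFlip]

theorem phaseOracle_eq_phaseFlip {N : ℕ} (a w : ℕ) (x : Fin N → Bool) :
    phaseOracle a w x = phaseFlip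
      {b | ∃ i : Fin N, (i : ℕ) = queryIndex b ∧ x i = true ∧ queryBit b = true} := by
  funext ψ b
  simp only [phaseOracle, phaseFlip, Set.mem_ofPred_eq]
  congr

theorem proj_smul (S : Finset (Fin l)) (m : S → Bool) (c : ℂ) (ψ : State l) :
    proj S m (c • ψ) = c • proj S m ψ := by
  funext b
  simp [proj]

theorem proj_sub (S : Finset (Fin l)) (m : S → Bool) (ψ φ : State l) :
    proj S m (ψ - φ) = proj S m ψ - proj S m φ := by
  funext b
  simp only [proj, Pi.sub_apply]
  split_ifs <;> simp

theorem normSq_proj (S : Finset (Fin l)) (m : S → Bool) (ψ : State l) :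
    normSq (proj S m ψ) = outcomeProb S ψ m := by
  simp only [normSq, proj, outcomeProb, Finset.sum_filter]
  refine Finset.sum_congr rfl fun b _ => ?_
  split_ifs <;> simp

theorem sum_normSq_proj (S : Finset (Fin l)) (ψ : State l) :
    ∑ m, normSq (proj S m ψ) = normSq ψ := by
  have h : ∀ m, normSq (proj S m ψ) = ∑ b, if S.restrict b = m then ‖ψ b‖ ^ 2 else 0 := by
    intro m
    rw [normSq_proj, outcomeProb, Finset.sum_filter]
  rw [Finset.sum_congr rfl fun m _ => h m, Finset.sum_comm]
  refine Finset.sum_congr rfl fun b _ => ?_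
  rw [Finset.sum_ite_eq, if_pos (Finset.mem_univ _)]

theorem proj_eq_smul_collapse (S : Finset (Fin l)) (m : S → Bool) (ψ : State l) :
    proj S m ψ = ((√(outcomeProb S ψ m) : ℝ) : ℂ) • collapse S ψ m := by
  by_cases h : outcomeProb S ψ m = 0
  · rw [normSq_eq_zero ((normSq_proj S m ψ).trans h)]
    simp [h]
  · have h0 : 0 ≤ outcomeProb S ψ m := normSq_proj S m ψ ▸ normSq_nonneg _
    have h1 : ((√(outcomeProb S ψ m) : ℝ) : ℂ) ≠ 0 := by
      exact_mod_cast (Real.sqrt_pos.2 (lt_of_le_of_ne h0 (Ne.symm h))).ne'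
    funext b
    simp only [proj, collapse, Pi.smul_apply, smul_eq_mul]
    split_ifs
    · field_simp
    · simp

theorem normSq_collapse {S : Finset (Fin l)} {m : S → Bool} {ψ : State l}
    (h : outcomeProb S ψ m ≠ 0) : normSq (collapse S ψ m) = 1 := by
  have h0 : 0 ≤ outcomeProb S ψ m := normSq_proj S m ψ ▸ normSq_nonneg _
  have h1 := normSq_proj S m ψ
  rw [proj_eq_smul_collapse, normSq_smul, Real.sq_sqrt h0] at h1
  exact mul_left_cancel₀ h (h1.trans (mul_one _).symm)

/-! ### Runs with unnormalized states -/

/-- The probability that running the steps from `ψ / ‖ψ‖` produces samples that `post` maps to `y`,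
multiplied by `‖ψ‖ ^ 2`, computed without normalizing the states after measurements. -/
def weight (O : State l → State l) (y : Bool) :
    List (Step l) → State l → (List (Basis l) → Bool) → ℝ
  | [], ψ, post => if post [] = y then normSq ψ else 0
  | s :: steps, ψ, post =>
      ∑ m : s.measured → Bool,
        if s.isQuery then weight O y steps (O (proj s.measured m (s.gate.1 *ᵥ ψ))) post
        else ∑ v : Basis l, ‖proj s.measured m (s.gate.1 *ᵥ ψ) v‖ ^ 2 /
          normSq (proj s.measured m (s.gate.1 *ᵥ ψ)) *
            weight O y steps (proj s.measured m (s.gate.1 *ᵥ ψ)) (fun vs => post (v :: vs))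

theorem weight_nonneg (O : State l → State l) (y : Bool) (steps : List (Step l)) :
    ∀ ψ post, 0 ≤ weight O y steps ψ post := by
  induction steps with
  | nil =>
    intro ψ post
    simp only [weight]
    split_ifs
    exacts [normSq_nonneg ψ, le_rfl]
  | cons s steps ih =>
    intro ψ post
    simp only [weight]
    refine Finset.sum_nonneg fun m _ => ?_
    split_ifs
    · exact ih _ _
    · exact Finset.sum_nonneg fun v _ =>
        mul_nonneg (div_nonneg (by positivity) (normSq_nonneg _)) (ih _ _)

theorem sum_weight (M : Set (Basis l)) (steps : List (Step l)) :
    ∀ ψ post, ∑ y, weight (phaseFlip M) y steps ψ post = normSq ψ := by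
  induction steps with
  | nil =>
    intro ψ post
    simp [weight]
  | cons s steps ih =>
    intro ψ post
    simp only [weight]
    rw [Finset.sum_comm, ← normSq_mulVec s.gate ψ, ← sum_normSq_proj s.measured]
    refine Finset.sum_congr rfl fun m _ => ?_
    split_ifs
    · rw [ih, normSq_phaseFlip]
    · rw [Finset.sum_comm]
      simp only [← Finset.mul_sum, ih, ← Finset.sum_mul, ← Finset.sum_div]
      by_cases h : normSq (proj s.measured m (s.gate.1 *ᵥ ψ)) = 0
      · simp [h]
      · change normSq _ / _ * _ = _
        rw [div_self h, one_mul]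

theorem weight_eq_zero (M : Set (Basis l)) (y : Bool) (steps : List (Step l)) {ψ : State l}
    (hψ : normSq ψ = 0) (post : List (Basis l) → Bool) :
    weight (phaseFlip M) y steps ψ post = 0 := by
  have h := sum_weight M steps ψ post
  rw [hψ] at h
  exact (Finset.sum_eq_zero_iff_of_nonneg fun y _ => weight_nonneg _ y steps ψ post).1 h y
    (Finset.mem_univ y)

/-- The scalar `c` is what makes the induction go through: an unnormalized branch is `√p` times the
collapsed unit state, so the factors `√p` of successive measurements accumulate in `c`. -/
theorem weight_smul (M : Set (Basis l)) (y : Bool) (steps : List (Step l)) :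
    ∀ (χ : State l) (c : ℝ) post, normSq χ = 1 →
      weight (phaseFlip M) y steps ((c : ℂ) • χ) post =
        c ^ 2 * outputProb (phaseFlip M) y steps χ post := by
  induction steps with
  | nil =>
    intro χ c post h
    simp only [weight, outputProb, normSq_smul, h]
    split_ifs <;> simp
  | cons s steps ih =>
    intro χ c post h
    simp only [weight, outputProb]
    rw [Finset.mul_sum]
    refine Finset.sum_congr rfl fun m _ => ?_
    have h0 : 0 ≤ outcomeProb s.measured (s.gate.1 *ᵥ χ) m :=
      normSq_proj s.measured m _ ▸ normSq_nonneg _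
    have hu : proj s.measured m (s.gate.1 *ᵥ ((c : ℂ) • χ)) =
        (((c * √(outcomeProb s.measured (s.gate.1 *ᵥ χ) m) : ℝ)) : ℂ) •
          collapse s.measured (s.gate.1 *ᵥ χ) m := by
      rw [Matrix.mulVec_smul, proj_smul, proj_eq_smul_collapse, smul_smul]
      push_cast
      rfl
    rw [hu]
    set p := outcomeProb s.measured (s.gate.1 *ᵥ χ) m with hp
    set χ' := collapse s.measured (s.gate.1 *ᵥ χ) m with hχ'
    -- For an impossible outcome the collapsed state is not a unit vector, so the induction
    -- hypothesis is unavailable; both sides vanish instead.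
    by_cases hp0 : p = 0
    · simp [hp0, weight_eq_zero M y steps normSq_zero,
        weight_eq_zero M y steps ((normSq_phaseFlip M 0).trans normSq_zero)]
    · have h1 : normSq χ' = 1 := normSq_collapse hp0
      by_cases hc : c = 0
      · simp [hc, weight_eq_zero M y steps normSq_zero,
        weight_eq_zero M y steps ((normSq_phaseFlip M 0).trans normSq_zero)]
      · have hsq : (c * √p) ^ 2 = c ^ 2 * p := by rw [mul_pow, Real.sq_sqrt h0]
        have hne : c ^ 2 * p ≠ 0 := mul_ne_zero (pow_ne_zero 2 hc) hp0
        split_ifs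
        · rw [phaseFlip_smul, ih _ _ _ ((normSq_phaseFlip M _).trans h1), hsq, mul_assoc]
        · rw [← mul_assoc, Finset.mul_sum]
          refine Finset.sum_congr rfl fun v _ => ?_
          rw [ih _ _ _ h1, normSq_smul, h1, hsq]
          simp only [Pi.smul_apply, smul_eq_mul, norm_mul, Complex.norm_real, mul_pow,
            Real.norm_eq_abs, sq_abs, Real.sq_sqrt h0]
          field_simp

theorem weight_eq_outputProb (M : Set (Basis l)) (y : Bool) (steps : List (Step l))
    (post : List (Basis l) → Bool) {χ : State l} (h : normSq χ = 1) :
    weight (phaseFlip M) y steps χ post = outputProb (phaseFlip M) y steps χ post := by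
  simpa using weight_smul M y steps χ 1 post h

/-! ### The hybrid argument -/

/-- The total squared amplitude on `M` that the queries see when the steps are run from `ψ` with
the trivial query operator. -/
def queryMass (M : Set (Basis l)) : List (Step l) → State l → ℝ
  | [], _ => 0
  | s :: steps, ψ =>
      ∑ m : s.measured → Bool,
        ((if s.isQuery then ∑ b, M.indicator (fun b =>
            ‖proj s.measured m (s.gate.1 *ᵥ ψ) b‖ ^ 2) b else 0) +
          queryMass M steps (proj s.measured m (s.gate.1 *ᵥ ψ)))

theorem queryMass_nonneg (M : Set (Basis l)) (steps : List (Step l)) :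
    ∀ ψ, 0 ≤ queryMass M steps ψ := by
  induction steps with
  | nil => exact fun _ => le_rfl
  | cons s steps ih =>
    intro ψ
    refine Finset.sum_nonneg fun m _ => add_nonneg ?_ (ih _)
    split_ifs
    · exact Finset.sum_nonneg fun b _ => Set.indicator_nonneg (fun _ _ => by positivity) _
    · exact le_rfl

/-- All the masses refer to the same run, and each query distributes at most the squared norm of its
state among disjoint sets. -/
theorem sum_queryMass_le {ι : Type*} [Fintype ι] (M : ι → Set (Basis l))
    (hM : Pairwise (Function.onFun Disjoint M)) (steps : List (Step l)) :
    ∀ ψ, ∑ i, queryMass (M i) steps ψ ≤ (steps.countP fun s => s.isQuery) * normSq ψ := by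
  induction steps with
  | nil => simp [queryMass]
  | cons s steps ih =>
    intro ψ
    simp only [queryMass]
    rw [Finset.sum_comm, ← normSq_mulVec s.gate ψ, ← sum_normSq_proj s.measured, Finset.mul_sum]
    refine Finset.sum_le_sum fun m _ => ?_
    set u := proj s.measured m (s.gate.1 *ᵥ ψ)
    rw [Finset.sum_add_distrib]
    have h2 := ih u
    by_cases hq : s.isQuery = true
    · have h1 : ∑ i, ∑ b, (M i).indicator (fun b => ‖u b‖ ^ 2) b ≤ normSq u := by
        rw [Finset.sum_comm]
        refine Finset.sum_le_sum fun b _ => ?_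
        by_cases hb : ∃ i, b ∈ M i
        · obtain ⟨i, hi⟩ := hb
          rw [Finset.sum_eq_single i]
          · rw [Set.indicator_of_mem hi]
          · intro j _ hj
            exact Set.indicator_of_notMem (fun h => (hM hj).le_bot ⟨h, hi⟩) _
          · simp
        · push Not at hb
          rw [Finset.sum_eq_zero fun i _ => Set.indicator_of_notMem (hb i) _]
          positivity
      simp only [hq, if_true, List.countP_cons]
      push_cast
      linarith
    · simp only [hq, List.countP_cons]
      simpa using h2

/-- Write `x + y = 2x - (x - y)` and apply the weighted Young inequality. The error involves `x`
alone, so that later only the run with the trivial oracle is charged. -/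
theorem norm_add_sq_le_weighted {ε : ℝ} (hε : 0 < ε) (x y : ℂ) :
    ‖x + y‖ ^ 2 ≤ (1 + ε) * ‖x - y‖ ^ 2 + (1 + 1 / ε) * (4 * ‖x‖ ^ 2) := by
  have h1 : ‖x + y‖ ≤ 2 * ‖x‖ + ‖x - y‖ := by
    calc ‖x + y‖ = ‖2 * x - (x - y)‖ := by ring_nf
      _ ≤ ‖2 * x‖ + ‖x - y‖ := norm_sub_le _ _
      _ = _ := by simp
  have h2 : ‖x + y‖ ^ 2 ≤ (2 * ‖x‖ + ‖x - y‖) ^ 2 := pow_le_pow_left₀ (norm_nonneg _) h1 2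
  have h3 : 0 ≤ (ε * ‖x - y‖ - 2 * ‖x‖) ^ 2 / ε := by positivity
  have h4 : (ε * ‖x - y‖ - 2 * ‖x‖) ^ 2 / ε =
      ε * ‖x - y‖ ^ 2 - 4 * ‖x - y‖ * ‖x‖ + 1 / ε * (4 * ‖x‖ ^ 2) := by
    field_simp
    ring
  nlinarith

theorem normSq_sub_phaseFlip_le {ε : ℝ} (hε : 0 < ε) (M : Set (Basis l)) (u v : State l) :
    normSq (u - phaseFlip M v) ≤ (1 + ε) * normSq (u - v) +
      (1 + 1 / ε) * (4 * ∑ b, M.indicator (fun b => ‖u b‖ ^ 2) b) := by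
  simp only [normSq, Finset.mul_sum, ← Finset.sum_add_distrib]
  refine Finset.sum_le_sum fun b _ => ?_
  simp only [Pi.sub_apply, phaseFlip]
  by_cases hb : b ∈ M
  · rw [if_pos hb, Set.indicator_of_mem hb, sub_neg_eq_add]
    exact norm_add_sq_le_weighted hε _ _
  · rw [if_neg hb, Set.indicator_of_notMem hb]
    nlinarith [mul_nonneg hε.le (sq_nonneg ‖u b - v b‖)]

/-! ### Affinity of output distributions -/

/-- Entrywise `(‖u b‖ - ‖v b‖)² ≤ ‖u b - v b‖²`. This is the source of the quadratic dependence of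
the affinity loss on the distance. -/
theorem normSq_add_sub_normSq_sub_le (u v : State l) :
    (normSq u + normSq v - normSq (u - v)) / 2 ≤ ∑ b, ‖u b‖ * ‖v b‖ := by
  have h : normSq u + normSq v ≤ ∑ b, (2 * (‖u b‖ * ‖v b‖)) + normSq (u - v) := by
    simp only [normSq, ← Finset.sum_add_distrib]
    refine Finset.sum_le_sum fun b _ => ?_
    have h1 := abs_norm_sub_norm_le (u b) (v b)
    have h2 := pow_le_pow_left₀ (abs_nonneg _) h1 2
    rw [sq_abs] at h2
    simp only [Pi.sub_apply]
    linarith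
  rw [← Finset.mul_sum] at h
  linarith

/-- Mixing the runs after a sample costs at most `‖u - v‖ ^ 2 / 2` in affinity. -/
theorem affinity_sample_ge (u v : State l) (F G : Bool → Basis l → ℝ)
    (hF : ∀ y w, 0 ≤ F y w) (hG : ∀ y w, 0 ≤ G y w)
    (sF : ∀ w, ∑ y, F y w = normSq u) (sG : ∀ w, ∑ y, G y w = normSq v)
    {C : ℝ} (hC : 0 ≤ C)
    (h : ∀ w, (normSq u + normSq v) / 2 - C ≤ ∑ y, √(F y w) * √(G y w)) :
    (normSq u + normSq v) / 2 - C - normSq (u - v) / 2 ≤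
      ∑ y, √(∑ w, ‖u w‖ ^ 2 / normSq u * F y w) * √(∑ w, ‖v w‖ ^ 2 / normSq v * G y w) := by
  have hR : 0 ≤ ∑ y, √(∑ w, ‖u w‖ ^ 2 / normSq u * F y w) *
      √(∑ w, ‖v w‖ ^ 2 / normSq v * G y w) :=
    Finset.sum_nonneg fun y _ => by positivity
  by_cases hu : normSq u = 0
  · have : normSq (u - v) = normSq v := by
      rw [normSq_eq_zero hu, zero_sub]
      simp [normSq]
    linarith
  by_cases hv : normSq v = 0
  · have : normSq (u - v) = normSq u := by rw [normSq_eq_zero hv, sub_zero]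
    linarith
  have hu0 := lt_of_le_of_ne (normSq_nonneg u) (Ne.symm hu)
  have hv0 := lt_of_le_of_ne (normSq_nonneg v) (Ne.symm hv)
  set r := √(normSq u) * √(normSq v) with hr
  have hr0 : 0 < r := mul_pos (Real.sqrt_pos.2 hu0) (Real.sqrt_pos.2 hv0)
  set β := ∑ w, ‖u w‖ * ‖v w‖ / r with hβ
  have hβr : β * r = ∑ w, ‖u w‖ * ‖v w‖ := by
    rw [hβ, ← Finset.sum_div, div_mul_cancel₀ _ hr0.ne']
  have hβ1 : β ≤ 1 := by
    rw [← mul_le_mul_iff_left₀ hr0, hβr, one_mul]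
    have := Real.sum_mul_le_sqrt_mul_sqrt Finset.univ (fun w => ‖u w‖) (fun w => ‖v w‖)
    exact this
  have hB : ∀ w, ∑ y, √(F y w) * √(G y w) ≤ r := by
    intro w
    have := Real.sum_sqrt_mul_sqrt_le Finset.univ (fun y => hF y w) (fun y => hG y w)
    rwa [sF, sG] at this
  have hb : (normSq u + normSq v) / 2 - C ≤ r := (h fun _ => false).trans (hB _)
  have hAM : r ≤ (normSq u + normSq v) / 2 := by
    have := two_mul_le_add_sq (√(normSq u)) (√(normSq v))
    rw [Real.sq_sqrt hu0.le, Real.sq_sqrt hv0.le] at this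
    rw [hr]
    linarith
  -- Cauchy–Schwarz over the sample `w`, for each output `y`: forgetting the sample can only raise
  -- the affinity.
  have hcs : ∑ w, ‖u w‖ * ‖v w‖ / r * ∑ y, √(F y w) * √(G y w) ≤
      ∑ y, √(∑ w, ‖u w‖ ^ 2 / normSq u * F y w) * √(∑ w, ‖v w‖ ^ 2 / normSq v * G y w) := by
    simp only [Finset.mul_sum]
    rw [Finset.sum_comm]
    refine Finset.sum_le_sum fun y _ => ?_
    refine le_of_eq_of_le (Finset.sum_congr rfl fun w _ => ?_)
      (Real.sum_sqrt_mul_sqrt_le Finset.univ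
        (f := fun w => ‖u w‖ ^ 2 / normSq u * F y w) (g := fun w => ‖v w‖ ^ 2 / normSq v * G y w)
        (fun w => mul_nonneg (by positivity) (hF y w))
        (fun w => mul_nonneg (by positivity) (hG y w)))
    rw [Real.sqrt_mul (by positivity), Real.sqrt_mul (by positivity), Real.sqrt_div (by positivity),
      Real.sqrt_div (by positivity), Real.sqrt_sq (norm_nonneg _), Real.sqrt_sq (norm_nonneg _), hr]
    field_simp
  have hlow : β * ((normSq u + normSq v) / 2 - C) ≤
      ∑ w, ‖u w‖ * ‖v w‖ / r * ∑ y, √(F y w) * √(G y w) := by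
    rw [hβ, Finset.sum_mul]
    exact Finset.sum_le_sum fun w _ => mul_le_mul_of_nonneg_left (h w) (by positivity)
  have hin := normSq_add_sub_normSq_sub_le u v
  -- The loss from averaging is `(1 - β)` times the branch bound, hence at most `(1 - β) r` by `hb`.
  -- By `hin` and `hAM` this is at most `r - (normSq u + normSq v) / 2 + normSq (u - v) / 2 ≤ normSq
  -- (u - v) / 2`.
  nlinarith [mul_nonneg (sub_nonneg.2 hβ1) (sub_nonneg.2 hb)]

/-- Runs with the trivial query operator and with the phase flip of `M` have output distributions
of large affinity, unless the queries of the former see much of `M`. -/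
theorem affinity_ge (M : Set (Basis l)) {ε : ℝ} (hε : 0 < ε) (steps : List (Step l)) :
    ∀ ψ φ post, (normSq ψ + normSq φ) / 2 -
        ((steps.countP fun s => !s.isQuery : ℕ) + 1) / 2 *
          (1 + ε) ^ (steps.countP fun s => s.isQuery) *
          (normSq (ψ - φ) + 4 * (1 + 1 / ε) * queryMass M steps ψ) ≤
      ∑ y, √(weight (phaseFlip ∅) y steps ψ post) * √(weight (phaseFlip M) y steps φ post) := by
  induction steps with
  | nil =>
    intro ψ φ post
    have h1 := normSq_add_sub_normSq_sub_le ψ φ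
    have h2 := Real.sum_mul_le_sqrt_mul_sqrt Finset.univ (fun w => ‖ψ w‖) (fun w => ‖φ w‖)
    have h3 : ∑ y, √(weight (phaseFlip ∅) y [] ψ post) * √(weight (phaseFlip M) y [] φ post) =
        √(normSq ψ) * √(normSq φ) := by
      rw [Finset.sum_eq_single (post [])]
      · simp [weight]
      · intro y _ hy
        simp [weight, hy.symm]
      · simp
    rw [h3]
    simp only [queryMass, List.countP_nil, Nat.cast_zero, pow_zero, mul_zero, add_zero]
    -- The end of the run costs half the squared distance, just like a sample; this is the `+ 1`
    -- next to the number of samples.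
    refine le_trans ?_ (h1.trans h2)
    linarith
  | cons s steps ih =>
    intro ψ φ post
    set P := steps.countP fun s => !s.isQuery
    set Q := steps.countP fun s => s.isQuery
    set D := 4 * (1 + 1 / ε) with hD
    have hD0 : 0 ≤ D := by positivity
    have key : ∀ m : s.measured → Bool,
        (normSq (proj s.measured m (s.gate.1 *ᵥ ψ)) +
            normSq (proj s.measured m (s.gate.1 *ᵥ φ))) / 2 -
          (((s :: steps).countP fun s => !s.isQuery : ℕ) + 1) / 2 *
            (1 + ε) ^ ((s :: steps).countP fun s => s.isQuery) *
            (normSq (proj s.measured m (s.gate.1 *ᵥ ψ) - proj s.measured m (s.gate.1 *ᵥ φ)) +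
              D * ((if s.isQuery then ∑ b, M.indicator (fun b =>
                ‖proj s.measured m (s.gate.1 *ᵥ ψ) b‖ ^ 2) b else 0) +
                queryMass M steps (proj s.measured m (s.gate.1 *ᵥ ψ)))) ≤
        ∑ y, √(if s.isQuery then weight (phaseFlip ∅) y steps
              (phaseFlip ∅ (proj s.measured m (s.gate.1 *ᵥ ψ))) post
            else ∑ v : Basis l, ‖proj s.measured m (s.gate.1 *ᵥ ψ) v‖ ^ 2 /
              normSq (proj s.measured m (s.gate.1 *ᵥ ψ)) * weight (phaseFlip ∅) y steps
                (proj s.measured m (s.gate.1 *ᵥ ψ)) (fun vs => post (v :: vs))) *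
          √(if s.isQuery then weight (phaseFlip M) y steps
              (phaseFlip M (proj s.measured m (s.gate.1 *ᵥ φ))) post
            else ∑ v : Basis l, ‖proj s.measured m (s.gate.1 *ᵥ φ) v‖ ^ 2 /
              normSq (proj s.measured m (s.gate.1 *ᵥ φ)) * weight (phaseFlip M) y steps
                (proj s.measured m (s.gate.1 *ᵥ φ)) (fun vs => post (v :: vs))) := by
      intro m
      generalize proj s.measured m (s.gate.1 *ᵥ ψ) = u
      generalize proj s.measured m (s.gate.1 *ᵥ φ) = v
      have hQ := queryMass_nonneg M steps u
      by_cases hq : s.isQuery = true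
      · simp only [hq, if_true, phaseFlip_empty, List.countP_cons]
        have h1 := ih u (phaseFlip M v) post
        rw [normSq_phaseFlip] at h1
        refine le_trans ?_ h1
        have h2 := normSq_sub_phaseFlip_le hε M u v
        set W := ∑ b, M.indicator (fun b => ‖u b‖ ^ 2) b
        -- The squared distance plus `D` times the mass still to be queried acts as a potential: a
        -- query increases it at most by the factor `1 + ε`.
        have h3 : normSq (u - phaseFlip M v) + D * queryMass M steps u ≤
            (1 + ε) * (normSq (u - v) + D * (W + queryMass M steps u)) := by
          have hW : 0 ≤ W := Finset.sum_nonneg fun b _ =>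
            Set.indicator_nonneg (fun _ _ => by positivity) _
          have h4 : 0 ≤ ε * (D * (W + queryMass M steps u)) := by positivity
          have h5 : (1 + 1 / ε) * (4 * W) = D * W := by rw [hD]; ring
          rw [h5] at h2
          linarith
        have h4 : 0 ≤ ((P : ℝ) + 1) / 2 * (1 + ε) ^ Q := by positivity
        have h5 := mul_le_mul_of_nonneg_left h3 h4
        simp only [Bool.not_true, Bool.false_eq_true, if_false, add_zero, pow_succ]
        change _ - ((P : ℝ) + 1) / 2 * ((1 + ε) ^ Q * (1 + ε)) * _ ≤
          _ - ((P : ℝ) + 1) / 2 * (1 + ε) ^ Q * _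
        linarith
      · simp only [hq, Bool.false_eq_true, if_false, List.countP_cons, zero_add]
        have hN := normSq_nonneg (u - v)
        have h1 := affinity_sample_ge u v
          (fun y w => weight (phaseFlip ∅) y steps u fun vs => post (w :: vs))
          (fun y w => weight (phaseFlip M) y steps v fun vs => post (w :: vs))
          (fun y w => weight_nonneg _ _ _ _ _) (fun y w => weight_nonneg _ _ _ _ _)
          (fun w => sum_weight _ _ _ _) (fun w => sum_weight _ _ _ _)
          (C := ((P : ℝ) + 1) / 2 * (1 + ε) ^ Q * (normSq (u - v) + D * queryMass M steps u))
          (by positivity) (fun w => ih u v _)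
        refine le_trans ?_ h1
        -- The current squared distance is dominated by the potential, so the cost of this sample is
        -- absorbed by raising the sample count by one.
        have h2 : normSq (u - v) ≤
            (1 + ε) ^ Q * (normSq (u - v) + D * queryMass M steps u) := by
          have h3 : 1 ≤ (1 + ε) ^ Q := one_le_pow₀ (by linarith)
          have h4 : 0 ≤ D * queryMass M steps u := by positivity
          nlinarith
        simp only [Bool.not_false, if_true, add_zero]
        push_cast
        change _ - ((P : ℝ) + 1 + 1) / 2 * (1 + ε) ^ Q * _ ≤ _
        linarith
    simp only [weight]
    have hsum := Finset.sum_le_sum fun m (_ : m ∈ Finset.univ) => key m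
    rw [Finset.sum_comm] at hsum
    -- The left sides add up exactly, by orthogonality of the projections; the right sides are
    -- merged by Cauchy–Schwarz over the measurement outcomes.
    refine le_trans (le_of_eq ?_) (hsum.trans (Finset.sum_le_sum fun y _ => ?_))
    · rw [Finset.sum_sub_distrib, ← Finset.mul_sum, Finset.sum_add_distrib, ← Finset.sum_div,
        Finset.sum_add_distrib, ← Finset.mul_sum, sum_normSq_proj, sum_normSq_proj, normSq_mulVec,
        normSq_mulVec]
      simp only [← proj_sub, ← Matrix.mulVec_sub]
      rw [sum_normSq_proj, normSq_mulVec]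
      simp only [queryMass]
    · refine Real.sum_sqrt_mul_sqrt_le Finset.univ (fun m => ?_) (fun m => ?_)
      all_goals
        split_ifs
        · exact weight_nonneg _ _ _ _ _
        · exact Finset.sum_nonneg fun v _ =>
            mul_nonneg (div_nonneg (by positivity) (normSq_nonneg _)) (weight_nonneg _ _ _ _ _)

/-! ### The lower bound -/

/-- Distributions on `Bool` that are concentrated on different values have small affinity. -/
theorem affinity_le_of_distinguishable (p q : Bool → ℝ) (hp : ∀ y, 0 ≤ p y) (hq : ∀ y, 0 ≤ q y)
    (sp : ∑ y, p y = 1) (sq : ∑ y, q y = 1) (h0 : 2 / 3 ≤ p false) (h1 : 2 / 3 ≤ q true) :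
    ∑ y, √(p y) * √(q y) ≤ 19 / 20 := by
  -- Weighted AM-GM with weight ratio near the optimal one: in the extreme case `a = 1/3`, `b = 2/3`
  -- one has `√(b / a) = √2 ≈ 7/5`.
  have hamgm : ∀ a b : ℝ, 0 ≤ a → 0 ≤ b → √a * √b ≤ 7 / 10 * a + 5 / 14 * b := by
    intro a b ha hb
    have h := sq_nonneg (7 * √a - 5 * √b)
    have ha' := Real.sq_sqrt ha
    have hb' := Real.sq_sqrt hb
    nlinarith
  simp only [Fintype.sum_bool] at *
  have h2 := hamgm _ _ (hp true) (hq true)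
  have h3 := hamgm _ _ (hq false) (hp false)
  linarith

theorem one_add_inv_succ_pow_le (n : ℕ) : (1 + 1 / ((n : ℝ) + 1)) ^ n ≤ 3 := by
  have h0 : (0 : ℝ) < n + 1 := by positivity
  have h1 : 1 + 1 / ((n : ℝ) + 1) ≤ Real.exp (1 / ((n : ℝ) + 1)) := by
    rw [add_comm]
    exact Real.add_one_le_exp _
  calc (1 + 1 / ((n : ℝ) + 1)) ^ n ≤ Real.exp (1 / ((n : ℝ) + 1)) ^ n :=
        pow_le_pow_left₀ (by positivity) h1 n
    _ = Real.exp (n * (1 / ((n : ℝ) + 1))) := (Real.exp_nat_mul _ n).symm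
    _ ≤ Real.exp 1 := by
        refine Real.exp_le_exp.2 ?_
        rw [mul_one_div, div_le_one h0]
        linarith
    _ ≤ 3 := Real.exp_one_lt_three.le

/-- The basis states on which a query reads position `i`. -/
def readSet {N : ℕ} (a w : ℕ) (i : Fin N) : Set (Basis (a + 1 + w)) :=
  {b | (i : ℕ) = queryIndex b ∧ queryBit b = true}

theorem phaseOracle_false {N : ℕ} (a w : ℕ) :
    phaseOracle a w (fun _ : Fin N => false) = phaseFlip ∅ := by
  funext ψ b
  simp [phaseOracle, phaseFlip]

theorem phaseOracle_single {N : ℕ} (a w : ℕ) (i : Fin N) :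
    phaseOracle a w (fun j : Fin N => decide (j = i)) = phaseFlip (readSet a w i) := by
  rw [phaseOracle_eq_phaseFlip]
  congr 1
  ext b
  constructor
  · rintro ⟨j, hj, hji, hb⟩
    rw [decide_eq_true_eq] at hji
    exact ⟨hji ▸ hj, hb⟩
  · rintro ⟨hi, hb⟩
    exact ⟨i, hi, by simp, hb⟩

theorem pairwise_disjoint_readSet {N : ℕ} (a w : ℕ) :
    Pairwise (Function.onFun Disjoint (readSet (N := N) a w)) := by
  intro i j hij
  refine Set.disjoint_left.2 fun b hi hj => hij (Fin.ext ?_)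
  exact hi.1.trans hj.1.symm

/-- Each single-item input forces an affinity drop of `1/20` from the all-zero input, so each
position needs its share of the query mass; the shares are then summed over all positions. -/
theorem search_lower_bound {N : ℕ} (A : Algorithm N) (hA : A.SolvesSearch) :
    (N : ℝ) / 20 ≤ 6 * (A.samples + 1) * (A.queries + 2) * A.queries := by
  set z := zeroState (A.indexQubits + 1 + A.workQubits)
  have hz : normSq z = 1 := normSq_zeroState
  set ε : ℝ := 1 / ((A.queries : ℝ) + 1) with hε
  have hε0 : 0 < ε := by positivity
  have hi : ∀ i : Fin N, (1 : ℝ) / 20 ≤ 6 * (A.samples + 1) * (A.queries + 2) *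
      queryMass (readSet A.indexQubits A.workQubits i) A.steps z := by
    intro i
    have h0 : 2 / 3 ≤ weight (phaseFlip ∅) false A.steps z A.post := by
      have := hA fun _ => false
      rwa [Algorithm.prob, phaseOracle_false, ← weight_eq_outputProb _ _ _ _ hz,
        show decide (∃ _ : Fin N, false = true) = false by simp] at this
    have h1 : 2 / 3 ≤ weight (phaseFlip (readSet A.indexQubits A.workQubits i)) true A.steps z
        A.post := by
      have := hA fun j => decide (j = i)
      rwa [Algorithm.prob, phaseOracle_single, ← weight_eq_outputProb _ _ _ _ hz,
        show decide (∃ j : Fin N, decide (j = i) = true) = true by simp] at this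
    have h2 := affinity_le_of_distinguishable
      (fun y => weight (phaseFlip ∅) y A.steps z A.post)
      (fun y => weight (phaseFlip (readSet A.indexQubits A.workQubits i)) y A.steps z A.post)
      (fun y => weight_nonneg _ _ _ _ _) (fun y => weight_nonneg _ _ _ _ _)
      ((sum_weight _ _ _ _).trans hz) ((sum_weight _ _ _ _).trans hz) h0 h1
    have h3 := (affinity_ge (readSet A.indexQubits A.workQubits i) hε0 A.steps z z A.post).trans h2
    rw [sub_self, normSq_zero, hz] at h3
    set W := queryMass (readSet A.indexQubits A.workQubits i) A.steps z
    have hW : 0 ≤ W := queryMass_nonneg _ _ _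
    change (1 + 1) / 2 - ((A.samples : ℝ) + 1) / 2 * (1 + ε) ^ A.queries *
      (0 + 4 * (1 + 1 / ε) * W) ≤ 19 / 20 at h3
    have h4 : 1 + 1 / ε = A.queries + 2 := by
      rw [hε, one_div_one_div]
      ring
    have h5 : (1 + ε) ^ A.queries ≤ 3 := one_add_inv_succ_pow_le _
    rw [h4] at h3
    have h6 := mul_le_mul_of_nonneg_right h5
      (show 0 ≤ ((A.samples : ℝ) + 1) / 2 * (4 * (A.queries + 2) * W) by positivity)
    linarith
  have hsum := Finset.sum_le_sum fun i (_ : i ∈ Finset.univ) => hi i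
  rw [← Finset.mul_sum, Finset.sum_const, Finset.card_univ, Fintype.card_fin, nsmul_eq_mul] at hsum
  have hq := sum_queryMass_le _
    (pairwise_disjoint_readSet (N := N) A.indexQubits A.workQubits) A.steps z
  rw [hz, mul_one] at hq
  have := mul_le_mul_of_nonneg_left hq
    (show (0 : ℝ) ≤ 6 * (A.samples + 1) * (A.queries + 2) by positivity)
  change _ ≤ 6 * ((A.samples : ℝ) + 1) * (A.queries + 2) * A.queries at this
  linarith

theorem rpow_le_queries_add_samples {N : ℕ} (A : Algorithm N) (hA : A.SolvesSearch) :
    1 / 9 * (N : ℝ) ^ (1 / 3 : ℝ) ≤ (A.queries : ℝ) + A.samples := by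
  have h := search_lower_bound A hA
  -- If there is a query, the factors are at most `2T`, `3T` and `T` with `T = Q + P`. Then `N ≤ 20
  -- * 6 * 6 * T ^ 3 = 720 * T ^ 3 ≤ (9 * T) ^ 3`.
  have h2 : ((A.samples + 1) * (A.queries + 2) * A.queries : ℝ) ≤
      6 * ((A.queries : ℝ) + A.samples) ^ 3 := by
    rcases Nat.eq_zero_or_pos A.queries with hq | hq
    · rw [hq]
      simp only [Nat.cast_zero, mul_zero]
      positivity
    · have hq' : (1 : ℝ) ≤ A.queries := by exact_mod_cast hq
      have hs : (0 : ℝ) ≤ A.samples := Nat.cast_nonneg _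
      calc ((A.samples + 1) * (A.queries + 2) * A.queries : ℝ)
          ≤ (2 * ((A.queries : ℝ) + A.samples)) * (3 * ((A.queries : ℝ) + A.samples)) *
            ((A.queries : ℝ) + A.samples) := by gcongr <;> linarith
        _ = _ := by ring
  have h3 : (N : ℝ) ≤ (9 * ((A.queries : ℝ) + A.samples)) ^ 3 := by
    have : (0 : ℝ) ≤ ((A.queries : ℝ) + A.samples) ^ 3 := by positivity
    rw [mul_pow]
    linarith
  have h4 := Real.rpow_le_rpow (Nat.cast_nonneg N) h3 (show (0 : ℝ) ≤ 1 / 3 by norm_num)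
  rw [← Real.rpow_natCast, ← Real.rpow_mul (by positivity)] at h4
  norm_num at h4
  linarith

/-! ### Runs without collapsing measurements, and gates -/

open scoped Kronecker

theorem outcomeProb_empty (ψ : State l) (m : (∅ : Finset (Fin l)) → Bool) :
    outcomeProb ∅ ψ m = normSq ψ := by
  rw [outcomeProb, normSq, Finset.filter_true_of_mem fun b _ => Subsingleton.elim _ _]

theorem collapse_empty {ψ : State l} (h : normSq ψ = 1) (m : (∅ : Finset (Fin l)) → Bool) :
    collapse ∅ ψ m = ψ := by
  funext b
  rw [collapse, if_pos (Subsingleton.elim _ _), outcomeProb_empty, h]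
  simp

theorem outputProb_query (O : State l → State l) (y : Bool)
    (g : Matrix.unitaryGroup (Basis l) ℂ) (steps : List (Step l)) {ψ : State l}
    (h : normSq ψ = 1) (post : List (Basis l) → Bool) :
    outputProb O y (⟨g, ∅, true⟩ :: steps) ψ post =
      outputProb O y steps (O (g.1 *ᵥ ψ)) post := by
  have h1 : normSq (g.1 *ᵥ ψ) = 1 := (normSq_mulVec g ψ).trans h
  simp only [outputProb, outcomeProb_empty, collapse_empty h1, h1]
  simp

theorem outputProb_sample (O : State l → State l) (y : Bool)
    (g : Matrix.unitaryGroup (Basis l) ℂ) (steps : List (Step l)) {ψ : State l}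
    (h : normSq ψ = 1) (post : List (Basis l) → Bool) :
    outputProb O y (⟨g, ∅, false⟩ :: steps) ψ post =
      ∑ v, ‖(g.1 *ᵥ ψ) v‖ ^ 2 *
        outputProb O y steps (g.1 *ᵥ ψ) (fun vs => post (v :: vs)) := by
  have h1 : normSq (g.1 *ᵥ ψ) = 1 := (normSq_mulVec g ψ).trans h
  simp only [outputProb, outcomeProb_empty, collapse_empty h1, h1]
  simp

theorem outputProb_const_ne (O : State l → State l) {y z : Bool} (hyz : z ≠ y)
    (steps : List (Step l)) : ∀ ψ, outputProb O y steps ψ (fun _ => z) = 0 := by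
  induction steps with
  | nil =>
    intro ψ
    simp [outputProb, hyz]
  | cons s steps ih =>
    intro ψ
    simp [outputProb, ih]

/-- Output `false` requires every sample to fail `f`: one success makes the remaining
post-processing constantly `true`. Since the state is unchanged, the failure probability factors. -/
theorem outputProb_sample_any (O : State l → State l) (f : Basis l → Bool)
    (g : Matrix.unitaryGroup (Basis l) ℂ) (steps : List (Step l)) {ψ : State l}
    (h : normSq ψ = 1) :
    outputProb O false (⟨g, ∅, false⟩ :: steps) ψ (fun vs => vs.any f) =
      (∑ v with f v = false, ‖(g.1 *ᵥ ψ) v‖ ^ 2) *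
        outputProb O false steps (g.1 *ᵥ ψ) (fun vs => vs.any f) := by
  rw [outputProb_sample O false g steps h, Finset.sum_filter, Finset.sum_mul]
  refine Finset.sum_congr rfl fun v _ => ?_
  cases hv : f v
  · simp [List.any_cons, hv]
  · simp only [List.any_cons, hv, Bool.true_or]
    rw [outputProb_const_ne O (by simp)]
    simp

/-- Splitting a basis state without workspace into the index register and the control qubit. -/
def splitBasis (a : ℕ) : Basis (a + 1 + 0) ≃ Basis a × Bool where
  toFun b := (fun j => b (Fin.castAdd 0 j.castSucc), b (Fin.castAdd 0 (Fin.last a)))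
  invFun p := Fin.snoc (α := fun _ => Bool) p.1 p.2
  left_inv b := Fin.snoc_init_self (α := fun _ => Bool) b
  right_inv p := by
    refine Prod.ext (funext fun j => ?_) ?_
    · exact Fin.snoc_castSucc (α := fun _ => Bool) p.2 p.1 j
    · exact Fin.snoc_last (α := fun _ => Bool) p.2 p.1

variable {a : ℕ}

/-- The state with amplitude `f i c` for index `i` and control bit `c`. -/
def toState (f : Basis a → Bool → ℂ) : State (a + 1 + 0) :=
  fun b => f (splitBasis a b).1 (splitBasis a b).2

/-- A gate acting separately on the index register and on the control qubit. -/
def productGate (V : Matrix.unitaryGroup (Basis a) ℂ) (g : Matrix.unitaryGroup Bool ℂ) :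
    Matrix.unitaryGroup (Basis (a + 1 + 0)) ℂ :=
  ⟨(V.1 ⊗ₖ g.1).submatrix (splitBasis a) (splitBasis a), by
    have h := Matrix.mem_unitaryGroup_iff.1 (Matrix.kronecker_mem_unitary V.2 g.2)
    rw [Matrix.mem_unitaryGroup_iff, Matrix.star_eq_conjTranspose, Matrix.conjTranspose_submatrix,
      Matrix.submatrix_mul_equiv, ← Matrix.star_eq_conjTranspose, h, Matrix.submatrix_one_equiv]⟩

theorem productGate_mulVec (V : Matrix.unitaryGroup (Basis a) ℂ) (g : Matrix.unitaryGroup Bool ℂ)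
    (f : Basis a → Bool → ℂ) :
    (productGate V g).1 *ᵥ toState f =
      toState fun i c => ∑ j, V.1 i j * ∑ d, g.1 c d * f j d := by
  have h : toState f ∘ (splitBasis a).symm = fun p => f p.1 p.2 := by
    funext p
    simp [toState]
  rw [productGate, Matrix.submatrix_mulVec_equiv, h]
  funext b
  simp only [Function.comp, toState, Matrix.mulVec, dotProduct, Fintype.sum_prod_type,
    Matrix.kroneckerMap_apply, Finset.mul_sum, mul_assoc]

theorem productGate_mulVec_mul (V : Matrix.unitaryGroup (Basis a) ℂ)
    (g : Matrix.unitaryGroup Bool ℂ) (h : State a) (k : Bool → ℂ) :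
    (productGate V g).1 *ᵥ toState (fun i c => h i * k c) =
      toState fun i c => (V.1 *ᵥ h) i * (g.1 *ᵥ k) c := by
  rw [productGate_mulVec]
  congr 1
  funext i c
  simp only [Matrix.mulVec, dotProduct]
  rw [Finset.sum_mul_sum]
  refine Finset.sum_congr rfl fun j _ => ?_
  rw [Finset.mul_sum]
  refine Finset.sum_congr rfl fun d _ => ?_
  ring

theorem productGate_one_mulVec (g : Matrix.unitaryGroup Bool ℂ) (f : Basis a → Bool → ℂ) :
    (productGate 1 g).1 *ᵥ toState f = toState fun i c => ∑ d, g.1 c d * f i d := by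
  rw [productGate_mulVec]
  congr 1
  funext i c
  simp [Matrix.one_apply]

theorem inv_sqrt_two_mul_self : ((√2 : ℝ) : ℂ)⁻¹ * ((√2 : ℝ) : ℂ)⁻¹ = 1 / 2 := by
  rw [← mul_inv, ← Complex.ofReal_mul, Real.mul_self_sqrt (by norm_num)]
  norm_num

/-- The Hadamard gate. -/
def hadamard : Matrix.unitaryGroup Bool ℂ :=
  ⟨Matrix.of fun b c => if b && c then -((√2 : ℝ) : ℂ)⁻¹ else ((√2 : ℝ) : ℂ)⁻¹, by
    rw [Matrix.mem_unitaryGroup_iff]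
    ext b c
    have h := inv_sqrt_two_mul_self
    cases b <;> cases c <;>
      simp [Matrix.mul_apply, Matrix.star_apply, Complex.conj_ofReal, h, -Complex.ofReal_inv] <;>
      norm_num⟩

/-- The diagonal gate that negates the amplitude of control bit `0`. -/
def negZ : Matrix.unitaryGroup Bool ℂ :=
  ⟨Matrix.diagonal fun b => if b then 1 else -1, by
    rw [Matrix.mem_unitaryGroup_iff]
    ext b c
    cases b <;> cases c <;> simp [Matrix.mul_apply, Matrix.star_apply]⟩

/-- The reflection in the hyperplane orthogonal to a real vector. -/
def householder (v : Basis l → ℝ) : Matrix.unitaryGroup (Basis l) ℂ :=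
  ⟨1 - ((2 / ∑ i, v i ^ 2 : ℝ) : ℂ) • Matrix.vecMulVec (fun i => (v i : ℂ)) (fun i => (v i : ℂ)), by
    have hs : star (1 - ((2 / ∑ i, v i ^ 2 : ℝ) : ℂ) •
        Matrix.vecMulVec (fun i => (v i : ℂ)) (fun i => (v i : ℂ))) =
        1 - ((2 / ∑ i, v i ^ 2 : ℝ) : ℂ) •
          Matrix.vecMulVec (fun i => (v i : ℂ)) (fun i => (v i : ℂ)) := by
      ext i j
      simp only [Matrix.star_apply, Matrix.sub_apply, Matrix.smul_apply, Matrix.vecMulVec_apply,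
        Matrix.one_apply, star_sub, smul_eq_mul, star_mul', RCLike.star_def, Complex.conj_ofReal,
        eq_comm (a := j) (b := i)]
      split_ifs <;> simp [mul_comm]
    have hP : Matrix.vecMulVec (fun i => (v i : ℂ)) (fun i => (v i : ℂ)) *
        Matrix.vecMulVec (fun i => (v i : ℂ)) (fun i => (v i : ℂ)) =
        ((∑ i, v i ^ 2 : ℝ) : ℂ) •
          Matrix.vecMulVec (fun i => (v i : ℂ)) (fun i => (v i : ℂ)) := by
      ext i j
      simp only [Matrix.mul_apply, Matrix.vecMulVec_apply, Matrix.smul_apply, smul_eq_mul,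
        Complex.ofReal_sum, Finset.sum_mul]
      refine Finset.sum_congr rfl fun k _ => ?_
      push_cast
      ring
    rw [Matrix.mem_unitaryGroup_iff, hs, sub_mul, mul_sub, mul_sub, one_mul, mul_one, one_mul,
      Matrix.smul_mul, Matrix.mul_smul, hP, smul_smul, smul_smul, ← Complex.ofReal_mul,
      ← Complex.ofReal_mul]
    -- For `v = 0` the coefficient is `2 / 0 = 0` and the gate is the identity.
    by_cases h : ∑ i, v i ^ 2 = 0
    · simp [h]
    · have h2 : (2 / ∑ i, v i ^ 2) * (2 / ∑ i, v i ^ 2) * ∑ i, v i ^ 2 =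
          (2 / ∑ i, v i ^ 2) + 2 / ∑ i, v i ^ 2 := by
        field_simp
        norm_num
      rw [h2, Complex.ofReal_add, add_smul]
      abel⟩

theorem householder_mulVec (v : Basis l → ℝ) (h : State l) (i : Basis l) :
    ((householder v).1 *ᵥ h) i =
      h i - ((2 / ∑ i, v i ^ 2 : ℝ) : ℂ) * (∑ j, (v j : ℂ) * h j) * v i := by
  simp only [householder, Matrix.sub_mulVec, Matrix.one_mulVec, Matrix.smul_mulVec,
    Matrix.vecMulVec_mulVec, Pi.sub_apply, Pi.smul_apply, smul_eq_mul, dotProduct,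
    MulOpposite.smul_eq_mul_unop, MulOpposite.unop_op]
  ring

/-! ### Grover iterations interleaved with samples -/

section Circuit

variable {N : ℕ} (x : Fin N → Bool)

/-- Whether the index register holds a marked position. -/
def marked (i : Basis a) : Bool := decide (∃ k : Fin N, (k : ℕ) = Nat.ofBits i ∧ x k = true)

theorem phaseOracle_toState (f : Basis a → Bool → ℂ) :
    phaseOracle a 0 x (toState f) =
      toState fun i c => if marked x i && c then -f i c else f i c := by
  funext b
  have h : (∃ i : Fin N, (i : ℕ) = queryIndex b ∧ x i = true ∧ queryBit b = true) ↔
      (marked x (splitBasis a b).1 && (splitBasis a b).2) = true := by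
    rw [Bool.and_eq_true, marked, decide_eq_true_eq]
    constructor
    · rintro ⟨i, h1, h2, h3⟩
      exact ⟨⟨i, h1, h2⟩, h3⟩
    · rintro ⟨⟨i, h1, h2⟩, h3⟩
      exact ⟨i, h1, h2, h3⟩
  simp only [phaseOracle, toState, h]

/-- The state in which index `i` has amplitude `h i` and the control bit tells whether `i` is
marked. -/
def markState (h : State a) : State (a + 1 + 0) :=
  toState fun i c => if c = marked x i then h i else 0

/-- The state with amplitudes `h` on the index register and `|+⟩` on the control qubit. -/
def plusState (h : State a) : State (a + 1 + 0) :=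
  toState fun i _ => h i * ((√2 : ℝ) : ℂ)⁻¹

/-- Phase kickback: on `|+⟩` the query produces `|+⟩` or `|-⟩`, and the Hadamard gate turns this
into a readable bit, so that a sample reveals whether its index is marked. -/
theorem hadamard_phaseOracle_plusState (h : State a) :
    (productGate 1 hadamard).1 *ᵥ phaseOracle a 0 x (plusState h) = markState x h := by
  rw [plusState, phaseOracle_toState, productGate_one_mulVec, markState]
  congr 1
  funext i c
  have h2 := inv_sqrt_two_mul_self
  cases hm : marked x i <;> cases c <;> simp [hadamard] <;> linear_combination (2 * h i) * h2

/-- Negate the amplitudes of all unmarked indices. -/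
def flipUnmarked (h : State a) : State a := fun i => if marked x i then h i else -h i

/-- The sign is applied while the mark is written in the control qubit; a second query then erases
the mark. Negating unmarked rather than marked indices supplies the global sign that the reflection
in `groverStep` lacks, so the product is the usual Grover iterate. -/
theorem phaseOracle_hadamard_negZ_markState (h : State a) :
    phaseOracle a 0 x ((productGate 1 (hadamard * negZ)).1 *ᵥ markState x h) =
      plusState (flipUnmarked x h) := by
  rw [markState, productGate_one_mulVec, phaseOracle_toState, plusState]
  congr 1
  funext i c
  cases hm : marked x i <;> cases c <;>
    simp [hadamard, negZ, flipUnmarked, hm, mul_comm]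

/-- One Grover iteration on the index register. -/
def groverStep (h : State a) : State a :=
  (householder fun _ => 1).1 *ᵥ flipUnmarked x h

theorem diffusion_plusState (V : Matrix.unitaryGroup (Basis a) ℂ) (h : State a) :
    (productGate V 1).1 *ᵥ plusState h = plusState (V.1 *ᵥ h) := by
  rw [plusState, productGate_mulVec_mul V 1 h fun _ => ((√2 : ℝ) : ℂ)⁻¹]
  simp [plusState]

theorem prepare_zeroState (V : Matrix.unitaryGroup (Basis a) ℂ) :
    (productGate V hadamard).1 *ᵥ zeroState (a + 1 + 0) = plusState (V.1 *ᵥ zeroState a) := by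
  have h : zeroState (a + 1 + 0) =
      toState fun i c => zeroState a i * (Pi.single false 1 : Bool → ℂ) c := by
    funext b
    have hb : b = (fun _ => false) ↔
        (splitBasis a b).1 = (fun _ => false) ∧ (splitBasis a b).2 = false := by
      rw [← (splitBasis a).injective.eq_iff, Prod.ext_iff]
      rfl
    simp only [zeroState, toState, Pi.single_apply, hb]
    split_ifs <;> simp_all
  rw [h, productGate_mulVec_mul, plusState]
  congr 1
  funext i c
  cases c <;> simp [hadamard]

theorem normSq_toState (f : Basis a → Bool → ℂ) :
    normSq (toState f) = ∑ i, ∑ c, ‖f i c‖ ^ 2 := by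
  rw [← Fintype.sum_prod_type' fun i c => ‖f i c‖ ^ 2]
  exact (splitBasis a).sum_comp fun p => ‖f p.1 p.2‖ ^ 2

theorem normSq_markState (h : State a) : normSq (markState x h) = normSq h := by
  rw [markState, normSq_toState]
  refine Finset.sum_congr rfl fun i _ => ?_
  cases marked x i <;> simp

theorem normSq_phaseOracle (ψ : State (a + 1 + 0)) :
    normSq (phaseOracle a 0 x ψ) = normSq ψ := by
  rw [phaseOracle_eq_phaseFlip, normSq_phaseFlip]

theorem normSq_groverStep (h : State a) : normSq (groverStep x h) = normSq h := by
  rw [groverStep, normSq_mulVec]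
  refine Finset.sum_congr rfl fun i _ => ?_
  unfold flipUnmarked
  split_ifs <;> simp

theorem normSq_plusState (h : State a) : normSq (plusState h) = normSq h := by
  rw [← normSq_markState (fun _ : Fin 0 => false) h, ← hadamard_phaseOracle_plusState,
    normSq_mulVec, normSq_phaseOracle]

/-- The probability that the control bit of `markState x h` is `0`. -/
def unmarkedMass (h : State a) : ℝ := ∑ i with marked x i = false, ‖h i‖ ^ 2

theorem sum_markState_queryBit (h : State a) :
    ∑ v with queryBit (a := a) (w := 0) v = false, ‖markState x h v‖ ^ 2 = unmarkedMass x h := by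
  rw [Finset.sum_filter, unmarkedMass, Finset.sum_filter]
  have h1 := (splitBasis a).sum_comp fun p : Basis a × Bool =>
    if p.2 = false then ‖(if p.2 = marked x p.1 then h p.1 else 0)‖ ^ 2 else 0
  refine h1.trans ?_
  rw [Fintype.sum_prod_type]
  refine Finset.sum_congr rfl fun i _ => ?_
  cases hm : marked x i <;> simp [hm]

/-- Rounds consisting of a Grover iteration, which takes two queries, and a sample. -/
def rounds (a : ℕ) : ℕ → List (Step (a + 1 + 0))
  | 0 => []
  | n + 1 => ⟨productGate 1 (hadamard * negZ), ∅, true⟩ ::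
      ⟨productGate (householder fun _ => 1) 1, ∅, true⟩ ::
      ⟨productGate 1 hadamard, ∅, false⟩ :: rounds a n

theorem outputProb_rounds (n : ℕ) : ∀ h : State a, normSq h = 1 →
    outputProb (phaseOracle a 0 x) false (rounds a n) (markState x h)
        (fun vs => vs.any fun v => queryBit (a := a) (w := 0) v) =
      ∏ j ∈ Finset.range n, unmarkedMass x ((groverStep x)^[j + 1] h) := by
  induction n with
  | zero =>
    intro h _
    simp [rounds, outputProb]
  | succ n ih =>
    intro h hh
    have h1 : normSq (groverStep x h) = 1 := (normSq_groverStep x h).trans hh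
    have h0 : normSq (flipUnmarked x h) = 1 := by
      rwa [groverStep, normSq_mulVec] at h1
    rw [rounds, outputProb_query _ _ _ _ ((normSq_markState x h).trans hh),
      phaseOracle_hadamard_negZ_markState,
      outputProb_query _ _ _ _ ((normSq_plusState _).trans h0), diffusion_plusState]
    change outputProb _ _ (_ :: _) (phaseOracle a 0 x (plusState (groverStep x h))) _ = _
    rw [outputProb_sample_any _ _ _ _
      ((normSq_phaseOracle x _).trans ((normSq_plusState _).trans h1)),
      hadamard_phaseOracle_plusState, sum_markState_queryBit, ih _ h1, Finset.prod_range_succ',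
      mul_comm]
    rfl

/-- Search by sampling after each of `n + 1` Grover states; `V` prepares the initial state of the
index register. -/
def groverSampling (hN : N ≤ 2 ^ a) (V : Matrix.unitaryGroup (Basis a) ℂ) (n : ℕ) :
    Algorithm N where
  indexQubits := a
  le_two_pow := hN
  workQubits := 0
  steps := ⟨productGate V hadamard, ∅, true⟩ :: ⟨productGate 1 hadamard, ∅, false⟩ :: rounds a n
  post := fun vs => vs.any fun v => queryBit (a := a) (w := 0) v

theorem prob_groverSampling_false (hN : N ≤ 2 ^ a) (V : Matrix.unitaryGroup (Basis a) ℂ) (n : ℕ) :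
    (groverSampling hN V n).prob x false =
      ∏ j ∈ Finset.range (n + 1), unmarkedMass x ((groverStep x)^[j] (V.1 *ᵥ zeroState a)) := by
  have h1 : normSq (V.1 *ᵥ zeroState a) = 1 := (normSq_mulVec _ _).trans normSq_zeroState
  change outputProb (phaseOracle a 0 x) false (_ :: _ :: rounds a n) (zeroState (a + 1 + 0))
    (fun vs => vs.any fun v => queryBit (a := a) (w := 0) v) = _
  rw [outputProb_query _ _ _ _ normSq_zeroState, prepare_zeroState]
  refine (outputProb_sample_any _ _ _ _
    ((normSq_phaseOracle x _).trans ((normSq_plusState _).trans h1))).trans ?_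
  rw [hadamard_phaseOracle_plusState, sum_markState_queryBit, outputProb_rounds x n _ h1,
    Finset.prod_range_succ', mul_comm]
  rfl

theorem prob_false_add_prob_true (A : Algorithm N) : A.prob x true + A.prob x false = 1 := by
  have h := sum_weight {b | ∃ i : Fin N, (i : ℕ) = queryIndex b ∧ x i = true ∧ queryBit b = true}
    A.steps (zeroState (A.indexQubits + 1 + A.workQubits)) A.post
  rw [Fintype.sum_bool, weight_eq_outputProb _ _ _ _ normSq_zeroState,
    weight_eq_outputProb _ _ _ _ normSq_zeroState, ← phaseOracle_eq_phaseFlip,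
    normSq_zeroState] at h
  exact h

theorem countP_rounds (n : ℕ) :
    (rounds a n).countP (fun s => s.isQuery) = 2 * n ∧
      (rounds a n).countP (fun s => !s.isQuery) = n := by
  induction n with
  | zero => simp [rounds]
  | succ n ih => simp [rounds, ih.1, ih.2]; ring

theorem groverSampling_queries_add_samples (hN : N ≤ 2 ^ a)
    (V : Matrix.unitaryGroup (Basis a) ℂ) (n : ℕ) :
    (groverSampling hN V n).queries + (groverSampling hN V n).samples = 3 * n + 2 := by
  have h := countP_rounds (a := a) n
  simp [Algorithm.queries, Algorithm.samples, groverSampling, h.1, h.2]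
  ring

theorem unmarkedMass_iterate_of_unmarked (hx : ∀ i, x i = false) {h : State a}
    (hh : normSq h = 1) (j : ℕ) : unmarkedMass x ((groverStep x)^[j] h) = 1 := by
  have h1 : ∀ j, normSq ((groverStep x)^[j] h) = 1 := by
    intro j
    induction j with
    | zero => exact hh
    | succ j ih => rw [Function.iterate_succ_apply', normSq_groverStep, ih]
  rw [unmarkedMass, Finset.filter_true_of_mem fun i _ => by simp [marked, hx]]
  exact h1 j

end Circuit

/-! ### Trigonometric estimates -/

/-- After `sin² = (1 - cos) / 2` the sum telescopes; multiplying by `sin (2θ)` avoids a division. -/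
theorem sum_sin_sq_odd_mul (θ : ℝ) (K : ℕ) :
    4 * Real.sin (2 * θ) * ∑ j ∈ Finset.range K, Real.sin ((2 * j + 1) * θ) ^ 2 =
      2 * K * Real.sin (2 * θ) - Real.sin (4 * K * θ) := by
  induction K with
  | zero => simp
  | succ K ih =>
    rw [Finset.sum_range_succ, mul_add, ih, Real.sin_sq_eq_half_sub]
    have h1 : 4 * ((K + 1 : ℕ) : ℝ) * θ = (4 * K * θ + 2 * θ) + 2 * θ := by push_cast; ring
    have h2 : Real.sin (4 * K * θ) = Real.sin ((4 * K * θ + 2 * θ) - 2 * θ) := by ring_nf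
    have h3 : 2 * ((2 * (K : ℝ) + 1) * θ) = 4 * K * θ + 2 * θ := by ring
    rw [h1, h2, h3]
    generalize 4 * (K : ℝ) * θ + 2 * θ = A
    rw [Real.sin_sub, Real.sin_add]
    push_cast
    ring

theorem cube_le_sum_odd_sq (K : ℕ) :
    (K : ℝ) ^ 3 ≤ ∑ j ∈ Finset.range K, (2 * (j : ℝ) + 1) ^ 2 := by
  induction K with
  | zero => simp
  | succ K ih =>
    rw [Finset.sum_range_succ]
    push_cast
    nlinarith [sq_nonneg (K : ℝ), (Nat.cast_nonneg K : (0 : ℝ) ≤ K)]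

theorem sum_sin_sq_ge {θ : ℝ} (h0 : 0 < θ) (h1 : θ ≤ Real.pi / 4) {K : ℕ} (hK : 5 ≤ K)
    (hs : 3 ≤ (K : ℝ) ^ 3 * Real.sin θ ^ 2) :
    6 / 5 ≤ ∑ j ∈ Finset.range K, Real.sin ((2 * j + 1) * θ) ^ 2 := by
  have hK' : (5 : ℝ) ≤ K := by exact_mod_cast hK
  have hK0 : (0 : ℝ) < K := by linarith
  have hpi := Real.pi_pos
  have hsin2 : 0 < Real.sin (2 * θ) := Real.sin_pos_of_pos_of_lt_pi (by linarith) (by linarith)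
  -- If `K sin (2θ) ≥ 1`, the angles equidistribute well enough: the closed form gives a sum of at
  -- least `K / 4 ≥ 5/4`. Otherwise all angles lie in `[0, π/2]`, where Jordan's inequality gives at
  -- least `4 θ² K³ / π² ≥ 12 / π²`.
  rcases le_or_gt 1 (K * Real.sin (2 * θ)) with h | h
  · have h2 := sum_sin_sq_odd_mul θ K
    have h3 := Real.sin_le_one (4 * K * θ)
    set S := ∑ j ∈ Finset.range K, Real.sin ((2 * j + 1) * θ) ^ 2
    have h4 : K * Real.sin (2 * θ) ≤ 4 * Real.sin (2 * θ) * S := by linarith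
    have h5 : (K : ℝ) ≤ 4 * S := by
      refine le_of_mul_le_mul_right ?_ hsin2
      linarith
    linarith
  · have h2 := Real.mul_le_sin (x := 2 * θ) (by linarith) (by linarith)
    have h3 : 4 * (K * θ) ≤ Real.pi := by
      have h4 : (K : ℝ) * (2 / Real.pi * (2 * θ)) ≤ 1 :=
        (mul_le_mul_of_nonneg_left h2 hK0.le).trans h.le
      have h5 : (K : ℝ) * (2 / Real.pi * (2 * θ)) = 4 * (K * θ) / Real.pi := by ring
      rwa [h5, div_le_one hpi] at h4
    have hterm : ∀ j ∈ Finset.range K, (2 / Real.pi * θ) ^ 2 * (2 * (j : ℝ) + 1) ^ 2 ≤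
        Real.sin ((2 * j + 1) * θ) ^ 2 := by
      intro j hj
      have hj' : (j : ℝ) + 1 ≤ K := by exact_mod_cast Finset.mem_range.1 hj
      have hle : (2 * (j : ℝ) + 1) * θ ≤ Real.pi / 2 := by nlinarith
      have h6 := Real.mul_le_sin (x := (2 * (j : ℝ) + 1) * θ) (by positivity) hle
      have h7 := pow_le_pow_left₀ (by positivity) h6 2
      refine le_of_eq_of_le ?_ h7
      ring
    have h8 := Finset.sum_le_sum hterm
    rw [← Finset.mul_sum] at h8
    have h9 := mul_le_mul_of_nonneg_left (cube_le_sum_odd_sq K) (sq_nonneg (2 / Real.pi * θ))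
    have h10 : Real.sin θ ^ 2 ≤ θ ^ 2 :=
      pow_le_pow_left₀ (Real.sin_nonneg_of_nonneg_of_le_pi h0.le (by linarith))
        (Real.sin_le h0.le) 2
    have h11 : 3 ≤ (K : ℝ) ^ 3 * θ ^ 2 :=
      hs.trans (mul_le_mul_of_nonneg_left h10 (by positivity))
    have h12 : 6 / 5 ≤ (2 / Real.pi * θ) ^ 2 * (K : ℝ) ^ 3 := by
      have h13 : (2 / Real.pi * θ) ^ 2 * (K : ℝ) ^ 3 = 4 * ((K : ℝ) ^ 3 * θ ^ 2) / Real.pi ^ 2 := by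
        ring
      rw [h13, le_div_iff₀ (by positivity)]
      have h14 := Real.pi_lt_d2
      nlinarith
    linarith

theorem prod_cos_sq_le {θ : ℝ} (h0 : 0 < θ) (h1 : θ ≤ Real.pi / 4) {K : ℕ} (hK : 5 ≤ K)
    (hs : 3 ≤ (K : ℝ) ^ 3 * Real.sin θ ^ 2) :
    ∏ j ∈ Finset.range K, Real.cos ((2 * j + 1) * θ) ^ 2 ≤ 1 / 3 := by
  have h2 := sum_sin_sq_ge h0 h1 hK hs
  calc ∏ j ∈ Finset.range K, Real.cos ((2 * j + 1) * θ) ^ 2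
      ≤ ∏ j ∈ Finset.range K, Real.exp (-Real.sin ((2 * j + 1) * θ) ^ 2) := by
        refine Finset.prod_le_prod (fun j _ => sq_nonneg _) fun j _ => ?_
        rw [Real.cos_sq']
        linarith [Real.add_one_le_exp (-Real.sin ((2 * j + 1) * θ) ^ 2)]
    _ = Real.exp (-∑ j ∈ Finset.range K, Real.sin ((2 * j + 1) * θ) ^ 2) := by
        rw [← Real.exp_sum, Finset.sum_neg_distrib]
    _ ≤ Real.exp (-(6 / 5)) := Real.exp_le_exp.2 (by linarith)
    _ ≤ 1 / 3 := by
        rw [Real.exp_neg, inv_eq_one_div]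
        refine one_div_le_one_div_of_le (by norm_num) ?_
        have h3 : Real.exp (6 / 5) = Real.exp 1 * Real.exp (1 / 5) := by
          rw [← Real.exp_add]
          norm_num
        have h4 := Real.add_one_le_exp (1 / 5 : ℝ)
        have h5 := Real.exp_one_gt_d9
        rw [h3]
        nlinarith

/-- A reflection maps `|0…0⟩` to the uniform superposition. -/
theorem exists_unitary_zeroState (a : ℕ) (ha : 0 < a) : ∃ V : Matrix.unitaryGroup (Basis a) ℂ,
    V.1 *ᵥ zeroState a = fun _ => (((√(2 ^ a))⁻¹ : ℝ) : ℂ) := by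
  set s : ℝ := (√(2 ^ a))⁻¹ with hs
  have hss : s ^ 2 * 2 ^ a = 1 := by
    rw [hs, inv_pow, Real.sq_sqrt (by positivity)]
    exact inv_mul_cancel₀ (by positivity)
  -- This needs `0 < a`: the squared length of the reflection vector is `2 (1 - s)`.
  have hs1 : 1 - s ≠ 0 := by
    intro h
    have : s = 1 := by linarith
    rw [this, one_pow, one_mul] at hss
    exact (one_lt_pow₀ (by norm_num : (1 : ℝ) < 2) ha.ne').ne' hss
  set e : Basis a → ℝ := Pi.single (fun _ => false) 1 with he
  have hsum : ∑ i, (e i - s) ^ 2 = 2 * (1 - s) := by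
    have h1 : ∀ i, (e i - s) ^ 2 = (1 - 2 * s) * e i + s ^ 2 := by
      intro i
      simp only [he, Pi.single_apply]
      split_ifs <;> ring
    simp only [h1, Finset.sum_add_distrib, ← Finset.mul_sum]
    simp only [he, Finset.sum_pi_single', Finset.mem_univ, if_true, Finset.sum_const,
      Finset.card_univ, Fintype.card_fun, Fintype.card_bool, Fintype.card_fin, nsmul_eq_mul]
    push_cast
    linarith
  refine ⟨householder fun i => e i - s, ?_⟩
  funext i
  rw [householder_mulVec, hsum]
  have h2 : ∑ j, ((e j - s : ℝ) : ℂ) * zeroState a j = ((1 - s : ℝ) : ℂ) := by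
    rw [Finset.sum_eq_single fun _ => false]
    · simp [zeroState, he]
    · intro j _ hj
      simp [zeroState, hj]
    · simp
  have h3 : zeroState a i = ((e i : ℝ) : ℂ) := by
    simp only [zeroState, he, Pi.single_apply]
    split_ifs <;> simp
  rw [h2, h3, ← Complex.ofReal_mul, ← Complex.ofReal_mul, ← Complex.ofReal_sub]
  congr 1
  field_simp
  ring

/-! ### Grover rotation in the plane of two-valued vectors -/

section Grover

variable {N : ℕ} (x : Fin N → Bool)

theorem card_marked_le : (Finset.univ.filter fun i : Basis a => marked x i = true).card ≤ N := by
  have h : ∀ i ∈ Finset.univ.filter (fun i : Basis a => marked x i = true),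
      Nat.ofBits i ∈ Finset.range N := by
    intro i hi
    have := (Finset.mem_filter.1 hi).2
    rw [marked, decide_eq_true_eq] at this
    obtain ⟨k, hk, -⟩ := this
    exact Finset.mem_range.2 (hk ▸ k.2)
  have hinj : Set.InjOn (fun i : Basis a => Nat.ofBits i)
      (Finset.univ.filter fun i : Basis a => marked x i = true) := by
    intro i _ j _ hij
    funext k
    have h1 := Nat.testBit_ofBits_lt i k k.2
    have h2 := Nat.testBit_ofBits_lt j k k.2
    rw [show Nat.ofBits i = Nat.ofBits j from hij] at h1
    exact h1.symm.trans h2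
  simpa using Finset.card_le_card_of_injOn _ h hinj

theorem card_marked_pos (hN : N ≤ 2 ^ a) {k : Fin N} (hk : x k = true) :
    0 < (Finset.univ.filter fun i : Basis a => marked x i = true).card := by
  refine Finset.card_pos.2 ⟨fun j => (k : ℕ).testBit j, ?_⟩
  simp only [Finset.mem_filter, Finset.mem_univ, true_and, marked, decide_eq_true_eq]
  refine ⟨k, ?_, hk⟩
  rw [Nat.ofBits_testBit, Nat.mod_eq_of_lt (k.2.trans_le hN)]

/-- The vector with entry `β` at marked and `α` at unmarked indices. -/
def twoValued (α β : ℝ) : State a := fun i => ((if marked x i then β else α : ℝ) : ℂ)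

theorem sum_ite_marked (α β : ℝ) :
    ∑ i : Basis a, (if marked x i then β else α) =
      (Finset.univ.filter fun i : Basis a => marked x i = true).card * β +
        (2 ^ a - (Finset.univ.filter fun i : Basis a => marked x i = true).card) * α := by
  have h := Finset.card_filter_add_card_filter_not (s := (Finset.univ : Finset (Basis a)))
    (fun i => marked x i = true)
  have h' : ((Finset.univ.filter fun i : Basis a => ¬marked x i = true).card : ℝ) =
      2 ^ a - (Finset.univ.filter fun i : Basis a => marked x i = true).card := by
    rw [eq_sub_iff_add_eq', ← Nat.cast_add, h]
    simp
  rw [Finset.sum_ite, Finset.sum_const, Finset.sum_const, nsmul_eq_mul, nsmul_eq_mul, h']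

theorem groverStep_twoValued (α β p : ℝ)
    (hp : ((Finset.univ.filter fun i : Basis a => marked x i = true).card : ℝ) = p * 2 ^ a) :
    groverStep x (twoValued (a := a) x α β) =
      twoValued x (2 * ((1 - p) * α - p * β) - α) (2 * ((1 - p) * α - p * β) + β) := by
  have h1 : flipUnmarked x (twoValued (a := a) x α β) = twoValued x (-α) β := by
    funext i
    unfold flipUnmarked twoValued
    split_ifs <;> simp
  funext i
  rw [groverStep, h1, householder_mulVec]
  have h2 : ∑ j : Basis a, ((1 : ℝ) : ℂ) * twoValued x (-α) β j =
      ((p * 2 ^ a * β + (2 ^ a - p * 2 ^ a) * -α : ℝ) : ℂ) := by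
    rw [← hp, ← sum_ite_marked]
    simp [twoValued]
  rw [h2, twoValued, twoValued, ← Complex.ofReal_mul, ← Complex.ofReal_mul, ← Complex.ofReal_sub]
  congr 1
  simp only [one_pow, Finset.sum_const, Finset.card_univ, Fintype.card_fun, Fintype.card_bool,
    Fintype.card_fin, nsmul_eq_mul]
  push_cast
  split_ifs <;> field_simp <;> ring

theorem unmarkedMass_twoValued (α β p : ℝ)
    (hp : ((Finset.univ.filter fun i : Basis a => marked x i = true).card : ℝ) = p * 2 ^ a) :
    unmarkedMass x (twoValued (a := a) x α β) = (1 - p) * 2 ^ a * α ^ 2 := by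
  have h := sum_ite_marked (a := a) x (α ^ 2) 0
  rw [hp] at h
  rw [unmarkedMass, Finset.sum_filter]
  refine Eq.trans (Finset.sum_congr rfl fun i _ => ?_) (h.trans (by ring))
  cases hm : marked x i <;> simp [twoValued, hm]

/-- With `sin² θ` the marked fraction, each iteration rotates by `2θ` in the plane spanned by the
marked and unmarked uniform vectors. Dividing by `cos θ` and `sin θ` converts plane coordinates into
entries. -/
theorem groverStep_iterate {θ : ℝ} (hsin : Real.sin θ ≠ 0) (hcos : Real.cos θ ≠ 0)
    (hp : ((Finset.univ.filter fun i : Basis a => marked x i = true).card : ℝ) =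
      Real.sin θ ^ 2 * 2 ^ a) (s : ℝ) (j : ℕ) :
    (groverStep x)^[j] (fun _ => (s : ℂ)) = twoValued (a := a) x
      (s * Real.cos ((2 * j + 1) * θ) / Real.cos θ)
      (s * Real.sin ((2 * j + 1) * θ) / Real.sin θ) := by
  induction j with
  | zero =>
    funext i
    simp [twoValued, hsin, hcos, -Complex.ofReal_sin, -Complex.ofReal_cos]
  | succ j ih =>
    rw [Function.iterate_succ_apply', ih, groverStep_twoValued x _ _ _ hp]
    set φ := (2 * (j : ℝ) + 1) * θ
    have h1 : (2 * ((j + 1 : ℕ) : ℝ) + 1) * θ = φ + (θ + θ) := by push_cast; ring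
    have hsq := Real.sin_sq_add_cos_sq θ
    have h2 : (1 - Real.sin θ ^ 2) * (s * Real.cos φ / Real.cos θ) -
        Real.sin θ ^ 2 * (s * Real.sin φ / Real.sin θ) =
        s * (Real.cos θ * Real.cos φ - Real.sin θ * Real.sin φ) := by
      rw [← Real.cos_sq']
      field_simp
    rw [h1, h2, Real.cos_add φ, Real.sin_add φ, Real.cos_add θ, Real.sin_add θ]
    congr 1
    · field_simp
      linear_combination (s * Real.cos φ) * hsq
    · field_simp
      linear_combination (-s * Real.sin φ) * hsq

/-- If a position is marked, sampling after each of `n + 1` Grover states rarely misses. -/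
theorem prob_groverSampling_false_le (hN : 2 * N ≤ 2 ^ a) (hN' : 2 ^ a ≤ 4 * N)
    (V : Matrix.unitaryGroup (Basis a) ℂ)
    (hV : V.1 *ᵥ zeroState a = fun _ => (((√(2 ^ a))⁻¹ : ℝ) : ℂ)) {n : ℕ} (hn : 4 ≤ n)
    (hn' : 12 * (N : ℝ) ≤ ((n + 1 : ℕ) : ℝ) ^ 3) {k : Fin N} (hk : x k = true) :
    (groverSampling (show N ≤ 2 ^ a by omega) V n).prob x false ≤ 1 / 3 := by
  set t := (Finset.univ.filter fun i : Basis a => marked x i = true).card with ht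
  have ht0 : 0 < t := card_marked_pos x (by omega) hk
  have htN : t ≤ N := card_marked_le x
  have hM : (0 : ℝ) < 2 ^ a := by positivity
  have ht1 : (1 : ℝ) ≤ t := by exact_mod_cast ht0
  have ht2 : 2 * (t : ℝ) ≤ 2 ^ a := by exact_mod_cast (show 2 * t ≤ 2 ^ a by omega)
  have hM4 : (2 : ℝ) ^ a ≤ 4 * N := by exact_mod_cast hN'
  set q : ℝ := t / 2 ^ a with hq
  have hq0 : 0 < q := by positivity
  have hq1 : q ≤ 1 / 2 := by
    rw [hq, div_le_iff₀ hM]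
    linarith
  set θ := Real.arcsin (√q) with hθ
  have hsq1 : √q ≤ √2 / 2 := by
    rw [Real.sqrt_le_left (by positivity), div_pow, Real.sq_sqrt (by norm_num)]
    linarith
  have hsq2 : √q ≤ 1 := by
    rw [Real.sqrt_le_left one_pos.le]
    linarith
  have hsin : Real.sin θ = √q := Real.sin_arcsin (by linarith [Real.sqrt_nonneg q]) hsq2
  have hsin2 : Real.sin θ ^ 2 = q := by rw [hsin, Real.sq_sqrt hq0.le]
  have hθ0 : 0 < θ := Real.arcsin_pos.2 (Real.sqrt_pos.2 hq0)
  have hpi := Real.pi_pos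
  have hθ1 : θ ≤ Real.pi / 4 := by
    rw [hθ, Real.arcsin_le_iff_le_sin' ⟨by linarith, by linarith⟩, Real.sin_pi_div_four]
    exact hsq1
  have hcos0 : Real.cos θ ≠ 0 :=
    (Real.cos_pos_of_mem_Ioo ⟨by linarith, by linarith⟩).ne'
  have hsin0 : Real.sin θ ≠ 0 := by
    rw [hsin]
    exact (Real.sqrt_pos.2 hq0).ne'
  have hp : (t : ℝ) = Real.sin θ ^ 2 * 2 ^ a := by
    rw [hsin2, hq, div_mul_cancel₀ _ hM.ne']
  rw [prob_groverSampling_false, hV]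
  have hmass : ∀ j, unmarkedMass x ((groverStep x)^[j]
      (fun _ : Basis a => (((√(2 ^ a))⁻¹ : ℝ) : ℂ))) = Real.cos ((2 * j + 1) * θ) ^ 2 := by
    intro j
    rw [groverStep_iterate x hsin0 hcos0 hp, unmarkedMass_twoValued x _ _ _ hp, ← Real.cos_sq',
      div_pow, mul_pow, inv_pow, Real.sq_sqrt hM.le]
    field_simp
  rw [Finset.prod_congr rfl fun j _ => hmass j]
  refine prod_cos_sq_le hθ0 hθ1 (by omega) ?_
  -- The required `3 * 2 ^ a ≤ (n + 1) ^ 3 * t` follows from `2 ^ a ≤ 4 * N`, `12 * N ≤ (n + 1) ^ 3`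
  -- and `1 ≤ t`.
  rw [hsin2, hq, mul_div_assoc', le_div_iff₀ hM]
  have h0 : (0 : ℝ) ≤ ((n + 1 : ℕ) : ℝ) ^ 3 := by positivity
  nlinarith

end Grover

theorem exists_search_algorithm {N : ℕ} (hN : 2 ≤ N) : ∃ A : Algorithm N, A.SolvesSearch ∧
    (A.queries : ℝ) + (A.samples : ℝ) ≤ 26 * (N : ℝ) ^ (1 / 3 : ℝ) := by
  set r := (N : ℝ) ^ (1 / 3 : ℝ) with hr
  have hN1 : (1 : ℝ) ≤ N := by exact_mod_cast (by omega : 1 ≤ N)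
  have hr1 : 1 ≤ r := Real.one_le_rpow hN1 (by norm_num)
  have hr3 : r ^ 3 = N := by
    rw [hr, ← Real.rpow_natCast, ← Real.rpow_mul (by positivity)]
    norm_num
  -- One index qubit more than necessary: at most half of all addresses are then marked, which keeps
  -- `θ ≤ π / 4`.
  set a := Nat.clog 2 N + 1 with ha
  have h1 : 2 * N ≤ 2 ^ a := by
    have := Nat.le_pow_clog (b := 2) (by norm_num) N
    rw [ha, pow_succ]
    omega
  have h2 : 2 ^ a ≤ 4 * N := by
    have := Nat.pow_pred_clog_lt_self (b := 2) (by norm_num) (x := N) (by omega)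
    have hpos : 0 < Nat.clog 2 N := Nat.clog_pos (by norm_num) hN
    obtain ⟨c, hc⟩ := Nat.exists_eq_succ_of_ne_zero hpos.ne'
    rw [hc] at this
    rw [ha, hc, pow_succ, pow_succ]
    rw [Nat.pred_succ] at this
    omega
  obtain ⟨V, hV⟩ := exists_unitary_zeroState a (by omega)
  -- Here `(3r)³ = 27 N` exceeds the required `12 N`, and the `+ 4` guarantees at least five
  -- samples. The total cost `3n + 2 ≤ 9r + 17` is at most `26r` because `1 ≤ r`.
  set n := ⌈3 * r⌉₊ + 4 with hn
  have hn1 : 3 * r ≤ ((n + 1 : ℕ) : ℝ) := by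
    have := Nat.le_ceil (3 * r)
    rw [hn]
    push_cast
    linarith
  have hn2 : (n : ℝ) ≤ 3 * r + 5 := by
    have := Nat.ceil_lt_add_one (a := 3 * r) (by linarith)
    rw [hn]
    push_cast
    linarith
  refine ⟨groverSampling (show N ≤ 2 ^ a by omega) V n, fun x => ?_, ?_⟩
  · by_cases hx : ∃ i, x i = true
    · rw [decide_eq_true hx]
      obtain ⟨k, hk⟩ := hx
      have h3 := prob_groverSampling_false_le x h1 h2 V hV (n := n) (by omega) ?_ hk
      · have h4 := prob_false_add_prob_true x (groverSampling (show N ≤ 2 ^ a by omega) V n)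
        linarith
      · have h5 := pow_le_pow_left₀ (by linarith) hn1 3
        rw [mul_pow, hr3] at h5
        linarith
    · rw [decide_eq_false hx, prob_groverSampling_false]
      rw [Finset.prod_eq_one fun j _ => unmarkedMass_iterate_of_unmarked x (fun i => by
        simpa using fun h => hx ⟨i, h⟩) ((normSq_mulVec _ _).trans normSq_zeroState) j]
      norm_num
  · have h3 := groverSampling_queries_add_samples (show N ≤ 2 ^ a by omega) V n
    have h4 : ((groverSampling (show N ≤ 2 ^ a by omega) V n).queries : ℝ) +
        (groverSampling (show N ≤ 2 ^ a by omega) V n).samples = 3 * n + 2 := by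
      exact_mod_cast h3
    rw [h4]
    linarith

end PDQP

end

theorem mainTheorem2 :
    (∃ c : ℝ, 0 < c ∧ ∀ (N : ℕ) (A : PDQP.Algorithm N), A.SolvesSearch →
      c * (N : ℝ) ^ (1 / 3 : ℝ) ≤ (A.queries : ℝ) + (A.samples : ℝ)) ∧
    (∃ (C : ℝ) (k : ℕ), 0 < C ∧ ∀ N : ℕ, 2 ≤ N → ∃ A : PDQP.Algorithm N, A.SolvesSearch ∧
      (A.queries : ℝ) + (A.samples : ℝ) ≤ C * (N : ℝ) ^ (1 / 3 : ℝ) * Real.log (N : ℝ) ^ k) := by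
  refine ⟨⟨1 / 9, by norm_num, fun N A hA => PDQP.rpow_le_queries_add_samples A hA⟩,
    -- Exponent `0`: the algorithm meets the bound without logarithmic loss.
    26, 0, by norm_num, fun N hN => ?_⟩
  obtain ⟨A, hA, hle⟩ := PDQP.exists_search_algorithm hN
  exact ⟨A, hA, by rwa [pow_zero, mul_one]⟩
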